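/- Let $\mathcal A$ be a (small) abelian category; all subcategories are full, additive and closed under isomorphism. A *torsion pair* in $\mathcal A$ is a pair $(\mathcal T,\mathcal F)$ of subcategories such that $\operatorname{Hom}(X,Y)=0$ for all $X\in\mathcal T$, $Y\in\mathcal F$, and every object $X$ lies in a short exact sequence $0\to tX\to X\to fX\to 0$ with $tX\in\mathcal T$ and $fX\in\mathcal F$. Then $\mathcal T$ is called a *torsion class*, $\mathcal F=\mathcal T^{\perp}=\{Y\mid \operatorname{Hom}(\mathcal T,Y)=0\}$, and $tX$ is the torsion subobject of $X$. Let $\operatorname{Tors}(\mathcal A)$ be the set of torsion classes. A *chain of torsion classes* is a family $\eta=(\mathcal T_s)_{s\in[0,1]}$ of torsion classes with $\mathcal T_0=\mathcal A$, $\mathcal T_1=\{0\}$ and $\mathcal T_s\subseteq\mathcal T_r$ for $r\le s$. Put $\mathcal F_s=\mathcal T_s^{\perp}$ and let $t_sM\subseteq M$ be the torsion subobject of $M$ with respect to $\mathcal T_s$. Let $\mathfrak T(\mathcal A)$ be the set of chains $\eta$ such that for every nonempty open interval $(a,b)\subseteq[0,1]$ and every object $M$ there are $s,s'\in(a,b)$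 with $t_{s'}M\subseteq t_rM\subseteq t_sM$ for all $r\in(a,b)$ ($\eta$ is weakly-Artinian and quasi-Noetherian). For $\eta\in\mathfrak T(\mathcal A)$ and $M\neq0$ put $$\mho_\eta(M)=\sup\{i\in[0,1]\mid M\in\mathcal T_i\},\qquad \Omega_\eta(M)=\inf\{i\in[0,1]\mid M\in\mathcal F_i\},$$ and let Bridgeland's pseudometric on $\mathfrak T(\mathcal A)$ be $$d(\eta_1,\eta_2)=\sup\{|\mho_{\eta_1}(M)-\mho_{\eta_2}(M)|,\ |\Omega_{\eta_1}(M)-\Omega_{\eta_2}(M)| \;:\; 0\ne M\in\mathcal A\}$$ (which is $0$ if $\mathcal A=0$). A *slicing* $\mathcal P$ of $\mathcal A$ consists of subcategories $\mathcal P_r$, $r\in[0,1]$, such that $\operatorname{Hom}(M,N)=0$ whenever $M\in\mathcal P_r$, $N\in\mathcal P_s$, $r>s$, and every nonzero object $M$ has a unique filtration $0=M_0\subsetneq M_1\subsetneq\dots\subsetneq M_n=M$ by subobjects with $M_i/M_{i-1}\in\mathcal P_{r_i}$ for some $r_1>r_2>\dots>r_n$ in $[0,1]$ (uniqueness includes the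 phases $r_i$). Let $\operatorname{Slice}(\mathcal A)$ be the set of slicings. Each $\eta\in\mathfrak T(\mathcal A)$ induces a slicing $\mathcal P^\eta$ given by $$\mathcal P^\eta_t=\bigcap_{s<t}\mathcal T_s\cap\bigcap_{s>t}\mathcal F_s ,\qquad s\in[0,1],$$ (an empty intersection being $\mathcal A$). Give $\operatorname{Slice}(\mathcal A)$ the quotient topology along $\mathfrak T(\mathcal A)\to\operatorname{Slice}(\mathcal A)$, $\eta\mapsto\mathcal P^\eta$, where $\mathfrak T(\mathcal A)$ carries the topology of the pseudometric $d$. **Theorem.** The space $\operatorname{Slice}(\mathcal A)$ is compact if and only if $\operatorname{Tors}(\mathcal A)$ is a finite set. -/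

import Mathlib

universe v u

open CategoryTheory CategoryTheory.Limits

namespace TorsionSlicing

noncomputable section

/-! ### Torsion pairs and torsion classes -/

/-- A full additive subcategory closed under isomorphisms, given by its objects: it contains the
zero objects and is closed under isomorphisms and finite (binary) direct sums. -/
structure IsAdditiveSubcategory {A : Type u} [Category.{v} A] [Abelian A]
    (P : ObjectProperty A) : Prop where
  of_isZero : ∀ X : A, IsZero X → P X
  of_iso : ∀ X Y : A, (X ≅ Y) → P X → P Y
  biprod : ∀ X Y : A, P X → P Y → P (X ⊞ Y)

/-- `(T, F)` is a torsion pair: there are no nonzero morphisms from `T` to `F`, and every object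
`X` lies in a short exact sequence `0 ⟶ tX ⟶ X ⟶ fX ⟶ 0` with `tX` in `T` and `fX` in `F`. -/
structure IsTorsionPair {A : Type u} [Category.{v} A] [Abelian A]
    (T F : ObjectProperty A) : Prop where
  additive_torsion : IsAdditiveSubcategory T
  additive_torsionfree : IsAdditiveSubcategory F
  hom_eq_zero : ∀ X Y : A, T X → F Y → ∀ f : X ⟶ Y, f = 0
  exists_shortExact : ∀ X : A, ∃ (tX fX : A) (i : tX ⟶ X) (p : X ⟶ fX) (w : i ≫ p = 0),
    (ShortComplex.mk i p w).ShortExact ∧ T tX ∧ F fX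

/-- The torsion classes of `A`. -/
def Tors (A : Type u) [Category.{v} A] [Abelian A] : Set (ObjectProperty A) :=
  {T | ∃ F : ObjectProperty A, IsTorsionPair T F}

theorem exists_torsionSubobject {A : Type u} [Category.{v} A] [Abelian A]
    {T : ObjectProperty A} (hT : T ∈ Tors A) (X : A) :
    ∃ S : Subobject X, T (S : A) ∧ T.rightOrthogonal (cokernel S.arrow) := by
  obtain ⟨F, h⟩ := hT
  obtain ⟨tX, fX, i, p, w, hex, ht, hf⟩ := h.exists_shortExact X
  have hmono : Mono i := hex.mono_f
  have hepi : Epi p := hex.epi_g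
  refine ⟨Subobject.mk i, h.additive_torsion.of_iso _ _ (Subobject.underlyingIso i).symm ht, ?_⟩
  intro Y f hY
  have e1 : cokernel (Subobject.mk i).arrow ≅ cokernel i :=
    (cokernelIsoOfEq (Subobject.underlyingIso_hom_comp_eq_mk i).symm).trans
      (cokernelEpiComp (Subobject.underlyingIso i).hom i)
  have e2 : cokernel i ≅ fX :=
    (cokernelIsCokernel i).coconePointUniqueUpToIso hex.gIsCokernel
  have := h.hom_eq_zero Y fX hY hf (f ≫ (e1 ≪≫ e2).hom)
  rwa [← cancel_mono (e1 ≪≫ e2).hom, zero_comp]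

/-- The torsion subobject of `X` with respect to the torsion class `T`: the subobject `tX` that
lies in `T` and whose cokernel lies in the torsionfree class `T^⊥`. -/
def torsionSubobject {A : Type u} [Category.{v} A] [Abelian A]
    {T : ObjectProperty A} (hT : T ∈ Tors A) (X : A) : Subobject X :=
  (exists_torsionSubobject hT X).choose

theorem torsionSubobject_mem {A : Type u} [Category.{v} A] [Abelian A]
    {T : ObjectProperty A} (hT : T ∈ Tors A) (X : A) : T (torsionSubobject hT X : A) :=
  (exists_torsionSubobject hT X).choose_spec.1

theorem cokernel_torsionSubobject {A : Type u} [Category.{v} A] [Abelian A]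
    {T : ObjectProperty A} (hT : T ∈ Tors A) (X : A) :
    T.rightOrthogonal (cokernel (torsionSubobject hT X).arrow) :=
  (exists_torsionSubobject hT X).choose_spec.2

theorem Tors.additive {A : Type u} [Category.{v} A] [Abelian A]
    {T : ObjectProperty A} (hT : T ∈ Tors A) : IsAdditiveSubcategory T := by
  obtain ⟨F, h⟩ := hT
  exact h.additive_torsion

theorem le_of_comp_cokernel_eq_zero {A : Type u} [Category.{v} A] [Abelian A] {X : A}
    (S S' : Subobject X) (h : S.arrow ≫ cokernel.π S'.arrow = 0) : S ≤ S' := by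
  have hk : IsLimit (KernelFork.ofι S'.arrow (cokernel.condition S'.arrow)) :=
    Abelian.monoIsKernelOfCokernel _ (colimit.isColimit (parallelPair S'.arrow 0))
  exact Subobject.le_of_comm (hk.lift (KernelFork.ofι S.arrow h))
    (hk.fac (KernelFork.ofι S.arrow h) WalkingParallelPair.zero)

theorem le_torsionSubobject {A : Type u} [Category.{v} A] [Abelian A]
    {T : ObjectProperty A} (hT : T ∈ Tors A) {X : A} (S : Subobject X) (hS : T (S : A)) :
    S ≤ torsionSubobject hT X :=
  le_of_comp_cokernel_eq_zero _ _ (cokernel_torsionSubobject hT X _ hS)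

/-- Torsion classes are closed under quotients. -/
theorem Tors.of_epi {A : Type u} [Category.{v} A] [Abelian A]
    {T : ObjectProperty A} (hT : T ∈ Tors A) {X Y : A} (p : X ⟶ Y) [Epi p] (hX : T X) : T Y := by
  have h0 : p ≫ cokernel.π (torsionSubobject hT Y).arrow = 0 :=
    cokernel_torsionSubobject hT Y _ hX
  have h1 : cokernel.π (torsionSubobject hT Y).arrow = 0 := by
    rwa [← cancel_epi p, comp_zero]
  have : Epi (torsionSubobject hT Y).arrow := Preadditive.epi_of_cokernel_zero h1
  have : IsIso (torsionSubobject hT Y).arrow := isIso_of_mono_of_epi _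
  exact (Tors.additive hT).of_iso _ _ (asIso (torsionSubobject hT Y).arrow)
    (torsionSubobject_mem hT Y)

/-! ### Harder-Narasimhan filtrations and slicings -/

/-- A Harder-Narasimhan filtration of `M` with respect to a family `P` of subcategories indexed by
`[0,1]`: a strictly increasing finite filtration `0 = M₀ ⊂ M₁ ⊂ ⋯ ⊂ Mₙ = M` by subobjects, and
phases `r₁ > r₂ > ⋯ > rₙ` in `[0,1]` such that `Mᵢ / Mᵢ₋₁` lies in `P rᵢ`. -/
@[ext]
structure HNFiltration {A : Type u} [Category.{v} A] [Abelian A]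
    (P : unitInterval → ObjectProperty A) (M : A) where
  length : ℕ
  sub : Fin (length + 1) → Subobject M
  phase : Fin length → unitInterval
  sub_zero : sub 0 = ⊥
  sub_last : sub (Fin.last length) = ⊤
  strictMono_sub : StrictMono sub
  strictAnti_phase : StrictAnti phase
  factor_mem : ∀ i : Fin length, P (phase i) (cokernel
    (Subobject.ofLE (sub i.castSucc) (sub i.succ) (strictMono_sub i.castSucc_lt_succ).le))

/-- A slicing of the abelian category `A`. -/
structure Slicing (A : Type u) [Category.{v} A] [Abelian A] where
  P : unitInterval → ObjectProperty A
  additive : ∀ r, IsAdditiveSubcategory (P r)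
  hom_eq_zero : ∀ r s, s < r → ∀ M N : A, P r M → P s N → ∀ f : M ⟶ N, f = 0
  exists_hn : ∀ M : A, ¬ IsZero M → Nonempty (HNFiltration P M)
  unique_hn : ∀ M : A, ¬ IsZero M → Subsingleton (HNFiltration P M)

/-! ### Chains of torsion classes -/

/-- A chain of torsion classes indexed by `[0,1]`: an order-reversing family of torsion classes
with `T 0 = A` and `T 1 = {0}`. -/
structure TorsionChain (A : Type u) [Category.{v} A] [Abelian A] where
  T : unitInterval → ObjectProperty A
  mem_tors : ∀ s, T s ∈ Tors A
  anti : ∀ r s, r ≤ s → ∀ M : A, T s M → T r M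
  zero_mem : ∀ M : A, T 0 M
  one_iff : ∀ M : A, T 1 M ↔ IsZero M

namespace TorsionChain

/-- The torsionfree class `F s = (T s)^⊥`. -/
def F {A : Type u} [Category.{v} A] [Abelian A] (η : TorsionChain A) (s : unitInterval) :
    ObjectProperty A :=
  (η.T s).rightOrthogonal

/-- The torsion subobject `t_s M` of `M` with respect to `T s`. -/
def t {A : Type u} [Category.{v} A] [Abelian A] (η : TorsionChain A) (s : unitInterval) (M : A) :
    Subobject M :=
  torsionSubobject (η.mem_tors s) M

/-- On each open interval `(a,b)` and for each `M` the family `t_r M` has a largest member. -/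
def QuasiNoetherian {A : Type u} [Category.{v} A] [Abelian A] (η : TorsionChain A) : Prop :=
  ∀ a b : unitInterval, a < b → ∀ M : A, ∃ s ∈ Set.Ioo a b, ∀ r ∈ Set.Ioo a b, η.t r M ≤ η.t s M

/-- On each open interval `(a,b)` and for each `M` the family `t_r M` has a smallest member. -/
def WeaklyArtinian {A : Type u} [Category.{v} A] [Abelian A] (η : TorsionChain A) : Prop :=
  ∀ a b : unitInterval, a < b → ∀ M : A, ∃ s ∈ Set.Ioo a b, ∀ r ∈ Set.Ioo a b, η.t s M ≤ η.t r M

/-- The quasisemistable objects of phase `t`: the intersection of the `T s` for `s < t` and of the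
`F s` for `s > t`. At `t = 0` and `t = 1` one of the two conditions is empty. -/
def phase {A : Type u} [Category.{v} A] [Abelian A] (η : TorsionChain A) (t : unitInterval) :
    ObjectProperty A :=
  fun M => (∀ s, s < t → η.T s M) ∧ ∀ s, t < s → η.F s M

/-- `℧_η(M) = sup {i ∈ [0,1] | M ∈ T i}`. -/
def mho {A : Type u} [Category.{v} A] [Abelian A] (η : TorsionChain A) (M : A) : ℝ :=
  sSup {x : ℝ | ∃ i : unitInterval, (i : ℝ) = x ∧ η.T i M}

/-- `Ω_η(M) = inf {i ∈ [0,1] | M ∈ F i}`. -/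
def omega {A : Type u} [Category.{v} A] [Abelian A] (η : TorsionChain A) (M : A) : ℝ :=
  sInf {x : ℝ | ∃ i : unitInterval, (i : ℝ) = x ∧ η.F i M}

end TorsionChain

/-- The space of all quasi-Noetherian and weakly-Artinian chains of torsion classes. -/
structure ChainSpace (A : Type u) [Category.{v} A] [Abelian A] extends TorsionChain A where
  quasiNoetherian : toTorsionChain.QuasiNoetherian
  weaklyArtinian : toTorsionChain.WeaklyArtinian

/-! ### The pseudometric on chains -/

/-- The set of all `|℧_{η₁}(M) - ℧_{η₂}(M)|` and `|Ω_{η₁}(M) - Ω_{η₂}(M)|`, `M` nonzero. -/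
def distSet {A : Type u} [Category.{v} A] [Abelian A] (η₁ η₂ : TorsionChain A) : Set ℝ :=
  {x | ∃ M : A, ¬ IsZero M ∧ (x = |η₁.mho M - η₂.mho M| ∨ x = |η₁.omega M - η₂.omega M|)}

theorem mho_mem {A : Type u} [Category.{v} A] [Abelian A] (η : TorsionChain A) (M : A) :
    η.mho M ∈ Set.Icc (0 : ℝ) 1 := by
  constructor
  · apply Real.sSup_nonneg
    rintro x ⟨i, rfl, -⟩
    exact i.2.1
  · apply Real.sSup_le _ zero_le_one
    rintro x ⟨i, rfl, -⟩
    exact i.2.2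

theorem omega_mem {A : Type u} [Category.{v} A] [Abelian A] (η : TorsionChain A) (M : A) :
    η.omega M ∈ Set.Icc (0 : ℝ) 1 := by
  have hb : BddBelow {x : ℝ | ∃ i : unitInterval, (i : ℝ) = x ∧ η.F i M} :=
    ⟨0, by rintro x ⟨i, rfl, -⟩; exact i.2.1⟩
  constructor
  · apply Real.sInf_nonneg
    rintro x ⟨i, rfl, -⟩
    exact i.2.1
  · apply csInf_le hb
    refine ⟨1, rfl, fun X f hX => ?_⟩
    exact ((η.one_iff X).1 hX).eq_of_src _ _

theorem distSet_bddAbove {A : Type u} [Category.{v} A] [Abelian A] (η₁ η₂ : TorsionChain A) :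
    BddAbove (distSet η₁ η₂) := by
  refine ⟨1, ?_⟩
  rintro x ⟨M, -, rfl | rfl⟩
  · have h1 := mho_mem η₁ M
    have h2 := mho_mem η₂ M
    rw [abs_le]
    constructor <;> linarith [h1.1, h1.2, h2.1, h2.2]
  · have h1 := omega_mem η₁ M
    have h2 := omega_mem η₂ M
    rw [abs_le]
    constructor <;> linarith [h1.1, h1.2, h2.1, h2.2]

theorem distSet_nonneg {A : Type u} [Category.{v} A] [Abelian A] (η₁ η₂ : TorsionChain A)
    (x : ℝ) (hx : x ∈ distSet η₁ η₂) : 0 ≤ x := by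
  obtain ⟨M, -, rfl | rfl⟩ := hx <;> exact abs_nonneg _

/-- Bridgeland's pseudometric: the supremum of `distSet η₁ η₂`. -/
instance {A : Type u} [Category.{v} A] [Abelian A] : PseudoMetricSpace (ChainSpace A) where
  dist η₁ η₂ := sSup (distSet η₁.toTorsionChain η₂.toTorsionChain)
  dist_self η := by
    apply le_antisymm
    · apply Real.sSup_le _ le_rfl
      rintro x ⟨M, -, rfl | rfl⟩ <;> simp
    · exact Real.sSup_nonneg (distSet_nonneg _ _)
  dist_comm η₁ η₂ := by
    congr 1
    ext x
    simp only [distSet, Set.mem_ofPred_eq, abs_sub_comm]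
  dist_triangle η₁ η₂ η₃ := by
    apply Real.sSup_le
    · rintro x ⟨M, hM, rfl | rfl⟩
      · exact (abs_sub_le _ (η₂.mho M) _).trans (add_le_add
          (le_csSup (distSet_bddAbove _ _) ⟨M, hM, Or.inl rfl⟩)
          (le_csSup (distSet_bddAbove _ _) ⟨M, hM, Or.inl rfl⟩))
      · exact (abs_sub_le _ (η₂.omega M) _).trans (add_le_add
          (le_csSup (distSet_bddAbove _ _) ⟨M, hM, Or.inr rfl⟩)
          (le_csSup (distSet_bddAbove _ _) ⟨M, hM, Or.inr rfl⟩))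
    · exact add_nonneg (Real.sSup_nonneg (distSet_nonneg _ _))
        (Real.sSup_nonneg (distSet_nonneg _ _))

/-! ### The slicing of a chain -/

section Steps

open Set Filter Topology

/-- A function on `[0,1]` that is antitone and locally stationary on both sides is a step function
with finitely many jumps. -/
theorem exists_steps {α : Type*} [PartialOrder α] [BoundedOrder α] (t : unitInterval → α)
    (ht : Antitone t) (h0 : t 0 = ⊤) (h1 : t 1 = ⊥)
    (hq : ∀ a b, a < b → ∃ s ∈ Ioo a b, ∀ r ∈ Ioo a b, t r ≤ t s)
    (hw : ∀ a b, a < b → ∃ s ∈ Ioo a b, ∀ r ∈ Ioo a b, t s ≤ t r) :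
    ∃ (n : ℕ) (sub : Fin (n + 1) → α) (phase : Fin n → unitInterval),
      sub 0 = ⊥ ∧ sub (Fin.last n) = ⊤ ∧ StrictMono sub ∧ StrictAnti phase ∧
      ∀ i, (∀ s, s < phase i → ∃ s', s ≤ s' ∧ s' < phase i ∧ t s' = sub i.succ) ∧
        (∀ s, phase i < s → ∃ s', phase i < s' ∧ s' ≤ s ∧ t s' = sub i.castSucc) := by
  have hL : ∀ x : unitInterval, ∃ L : α, (x = 0 → L = ⊤) ∧ (∀ r, r < x → L ≤ t r) ∧ t x ≤ L ∧
      (0 < x → ∃ s₀, s₀ < x ∧ ∀ s, s₀ ≤ s → s < x → t s = L) := by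
    intro x
    rcases eq_or_lt_of_le (unitInterval.nonneg' (t := x)) with hx | hx
    · subst hx
      exact ⟨⊤, fun _ => rfl, fun r hr => absurd hr (not_lt.2 unitInterval.nonneg'), le_top,
        fun h => absurd h (lt_irrefl _)⟩
    · obtain ⟨s, hs, hmin⟩ := hw 0 x hx
      have key : ∀ r, r < x → t s ≤ t r := by
        intro r hr
        rcases lt_or_ge r s with h | h
        · exact ht h.le
        · exact hmin r ⟨hs.1.trans_le h, hr⟩
      exact ⟨t s, fun h => absurd h hx.ne', key, ht hs.2.le,
        fun _ => ⟨s, hs.2, fun r h1 h2 => le_antisymm (ht h1) (key r h2)⟩⟩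
  have hR : ∀ x : unitInterval, ∃ R : α, (x = 1 → R = ⊥) ∧ (∀ r, x < r → t r ≤ R) ∧ R ≤ t x ∧
      (x < 1 → ∃ s₀, x < s₀ ∧ ∀ s, x < s → s ≤ s₀ → t s = R) := by
    intro x
    rcases eq_or_lt_of_le (unitInterval.le_one' (t := x)) with hx | hx
    · subst hx
      exact ⟨⊥, fun _ => rfl, fun r hr => absurd hr (not_lt.2 unitInterval.le_one'), bot_le,
        fun h => absurd h (lt_irrefl _)⟩
    · obtain ⟨s, hs, hmax⟩ := hq x 1 hx
      have key : ∀ r, x < r → t r ≤ t s := by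
        intro r hr
        rcases lt_or_ge s r with h | h
        · exact ht h.le
        · exact hmax r ⟨hr, h.trans_lt hs.2⟩
      exact ⟨t s, fun h => absurd h hx.ne, key, ht hs.1.le,
        fun _ => ⟨s, hs.1, fun r h1 h2 => le_antisymm (key r h1) (ht h2)⟩⟩
  choose L L0 Lle tL Lc using hL
  choose R R1 leR Rt Rc using hR
  set S : Set unitInterval := {x | ¬ ∀ᶠ r in 𝓝 x, t r = t x} with hS
  have evL : ∀ x, ∀ᶠ r in 𝓝[<] x, t r = L x := by
    intro x
    rcases eq_or_lt_of_le (unitInterval.nonneg' (t := x)) with hx | hx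
    · subst hx
      filter_upwards [self_mem_nhdsWithin] with r hr
      exact absurd hr (not_lt.2 unitInterval.nonneg')
    · obtain ⟨s, hs, hc⟩ := Lc x hx
      filter_upwards [Ioo_mem_nhdsLT hs] with r hr
      exact hc r hr.1.le hr.2
  have evR : ∀ x, ∀ᶠ r in 𝓝[>] x, t r = R x := by
    intro x
    rcases eq_or_lt_of_le (unitInterval.le_one' (t := x)) with hx | hx
    · subst hx
      filter_upwards [self_mem_nhdsWithin] with r hr
      exact absurd hr (not_lt.2 unitInterval.le_one')
    · obtain ⟨s, hs, hc⟩ := Rc x hx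
      filter_upwards [Ioo_mem_nhdsGT hs] with r hr
      exact hc r hr.1 hr.2.le
  have notS : ∀ (J : Set unitInterval), IsOpen J → ∀ c, (∀ r ∈ J, t r = c) → ∀ x ∈ J, x ∉ S := by
    intro J hJ c hc x hx hxS
    apply hxS
    filter_upwards [hJ.mem_nhds hx] with r hr
    rw [hc r hr, hc x hx]
  have Sfin : S.Finite := by
    by_contra hinf
    obtain ⟨x, hx⟩ := Set.Infinite.exists_accPt_principal hinf
    rw [accPt_iff_frequently] at hx
    apply hx
    suffices h : ∀ᶠ y in 𝓝[≠] x, y ∉ S by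
      rw [eventually_nhdsWithin_iff] at h
      exact h.mono fun y hy hy' => hy hy'.1 hy'.2
    rw [← nhdsLT_sup_nhdsGT, eventually_sup]
    constructor
    · rcases eq_or_lt_of_le (unitInterval.nonneg' (t := x)) with hx | hx
      · subst hx
        filter_upwards [self_mem_nhdsWithin] with r hr
        exact absurd hr (not_lt.2 unitInterval.nonneg')
      · obtain ⟨s, hs, hc⟩ := Lc x hx
        filter_upwards [Ioo_mem_nhdsLT hs] with r hr
        exact notS _ isOpen_Ioo _ (fun r hr => hc r hr.1.le hr.2) r hr
    · rcases eq_or_lt_of_le (unitInterval.le_one' (t := x)) with hx | hx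
      · subst hx
        filter_upwards [self_mem_nhdsWithin] with r hr
        exact absurd hr (not_lt.2 unitInterval.le_one')
      · obtain ⟨s, hs, hc⟩ := Rc x hx
        filter_upwards [Ioo_mem_nhdsGT hs] with r hr
        exact notS _ isOpen_Ioo _ (fun r hr => hc r hr.1 hr.2.le) r hr
  have const : ∀ J : Set unitInterval, J.OrdConnected → (∀ x ∈ J, x ∉ S) →
      ∀ x ∈ J, ∀ y ∈ J, t x = t y := by
    intro J hJ hJS x hx y hy
    let _ : TopologicalSpace α := ⊥
    have : DiscreteTopology α := ⟨rfl⟩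
    refine IsPreconnected.constant hJ.isPreconnected (f := t) ?_ hx hy
    intro z hz
    apply ContinuousAt.continuousWithinAt
    have : ∀ᶠ r in 𝓝 z, t r = t z := not_not.1 (hJS z hz)
    exact tendsto_const_nhds.congr' (this.mono fun r hr => hr.symm)
  have RL : ∀ x ∈ S, R x < L x := by
    intro x hx
    refine lt_of_le_of_ne ((Rt x).trans (tL x)) fun h => hx ?_
    have ex : t x = L x := le_antisymm (tL x) (h ▸ Rt x)
    rw [← nhdsNE_sup_pure, eventually_sup, ← nhdsLT_sup_nhdsGT, eventually_sup]
    refine ⟨⟨(evL x).mono fun r hr => by rw [hr, ex], (evR x).mono fun r hr => by rw [hr, h, ex]⟩, ?_⟩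
    simp
  have gap : ∀ x y, x < y → (∀ z ∈ Ioo x y, z ∉ S) → R x = L y := by
    intro x y hxy h
    obtain ⟨s, hs, hsc⟩ := Lc y (unitInterval.nonneg'.trans_lt hxy)
    obtain ⟨s', hs', hsc'⟩ := Rc x (hxy.trans_le unitInterval.le_one')
    obtain ⟨a, ha1, ha2⟩ := exists_between (max_lt hxy hs)
    obtain ⟨b, hb1, hb2⟩ := exists_between (lt_min hxy hs')
    rw [max_lt_iff] at ha1
    rw [lt_min_iff] at hb2
    rw [← hsc a ha1.2.le ha2, ← hsc' b hb1 hb2.2.le]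
    exact const _ ordConnected_Ioo h _ ⟨hb1, hb2.1⟩ _ ⟨ha1.1, ha2⟩
  have gapR : ∀ x, (∀ z, x < z → z ∉ S) → R x = ⊥ := by
    intro x h
    rcases eq_or_lt_of_le (unitInterval.le_one' (t := x)) with hx | hx
    · exact R1 x hx
    · obtain ⟨s', hs', hsc'⟩ := Rc x hx
      rw [← hsc' s' hs' le_rfl, ← h1]
      exact const _ ordConnected_Ioi h _ hs' _ hx
  have gapL : ∀ x, (∀ z, z < x → z ∉ S) → L x = ⊤ := by
    intro x h
    rcases eq_or_lt_of_le (unitInterval.nonneg' (t := x)) with hx | hx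
    · exact L0 x hx.symm
    · obtain ⟨s', hs', hsc'⟩ := Lc x hx
      rw [← hsc' s' le_rfl hs', ← h0]
      exact const _ ordConnected_Iio h _ hs' _ hx
  set n := Sfin.toFinset.card with hn
  set e := Sfin.toFinset.orderEmbOfFin hn.symm with he
  have he_mem : ∀ i, e i ∈ S := fun i => by
    have := Finset.orderEmbOfFin_mem Sfin.toFinset hn.symm i
    exact Sfin.mem_toFinset.1 this
  have he_ex : ∀ x ∈ S, ∃ i, e i = x := fun x hx => by
    have : x ∈ Set.range e := by
      rw [he, Finset.range_orderEmbOfFin]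
      simpa using hx
    exact this
  obtain ⟨phase, hphase⟩ : ∃ phase : Fin n → unitInterval, phase = fun i => e i.rev := ⟨_, rfl⟩
  have hp : StrictAnti phase := by
    intro i j hij
    rw [hphase]
    exact e.strictMono (Fin.rev_lt_rev.2 hij)
  have p_mem : ∀ i, phase i ∈ S := fun i => by rw [hphase]; exact he_mem _
  have p_ex : ∀ x ∈ S, ∃ i, phase i = x := fun x hx => by
    obtain ⟨i, hi⟩ := he_ex x hx
    exact ⟨i.rev, by rw [hphase]; simpa using hi⟩
  clear_value n
  obtain ⟨sub, hsub⟩ : ∃ sub : Fin (n + 1) → α,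
    sub = (Fin.cons ⊥ (fun i => L (phase i)) : Fin (n + 1) → α) := ⟨_, rfl⟩
  have sub_zero : sub 0 = ⊥ := by rw [hsub]; rfl
  have sub_succ : ∀ i : Fin n, sub i.succ = L (phase i) := fun i => by rw [hsub]; rfl
  have sub_cast : ∀ i : Fin n, sub i.castSucc = R (phase i) := by
    intro i
    cases n with
    | zero => exact i.elim0
    | succ m =>
      induction i using Fin.cases with
      | zero =>
        rw [Fin.castSucc_zero, sub_zero, gapR]
        intro z hz hzS
        obtain ⟨j, rfl⟩ := p_ex z hzS
        exact absurd (hp.lt_iff_gt.1 hz) (Fin.not_lt_zero _)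
      | succ i =>
        rw [← Fin.succ_castSucc, sub_succ, gap _ _ (hp i.castSucc_lt_succ)]
        intro z hz hzS
        obtain ⟨j, rfl⟩ := p_ex z hzS
        have h1 := hp.lt_iff_gt.1 hz.1
        have h2 := hp.lt_iff_gt.1 hz.2
        rw [Fin.lt_def] at h1 h2
        simp at h1 h2
        omega
  refine ⟨n, sub, phase, sub_zero, ?_, ?_, hp, ?_⟩
  · cases n with
    | zero =>
      have : t 0 = t 1 := const univ ordConnected_univ
        (fun x _ hx => by obtain ⟨i, -⟩ := p_ex x hx; exact i.elim0) _ trivial _ trivial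
      rw [h0, h1] at this
      rw [this]
      exact sub_zero
    | succ m =>
      rw [← Fin.succ_last, sub_succ, gapL]
      intro z hz hzS
      obtain ⟨j, rfl⟩ := p_ex z hzS
      exact absurd (hp.lt_iff_gt.1 hz) (not_lt.2 (Fin.le_last _))
  · rw [Fin.strictMono_iff_lt_succ]
    intro i
    rw [sub_cast, sub_succ]
    exact RL _ (p_mem i)
  · intro i
    rw [sub_cast, sub_succ]
    constructor
    · intro s hs
      obtain ⟨s₀, h1, h2⟩ := Lc (phase i) (unitInterval.nonneg'.trans_lt hs)
      exact ⟨max s s₀, le_max_left _ _, max_lt hs h1, h2 _ (le_max_right _ _) (max_lt hs h1)⟩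
    · intro s hs
      obtain ⟨s₀, h1, h2⟩ := Rc (phase i) (hs.trans_le unitInterval.le_one')
      exact ⟨min s s₀, lt_min hs h1, min_le_left _ _, h2 _ (lt_min hs h1) (min_le_right _ _)⟩

end Steps

theorem exists_lift {A : Type u} [Category.{v} A] [Abelian A] {X Y Z : A} (i : X ⟶ Y) [Mono i]
    (k : Z ⟶ Y) (h : k ≫ cokernel.π i = 0) : ∃ l : Z ⟶ X, l ≫ i = k := by
  have hk : IsLimit (KernelFork.ofι i (cokernel.condition i)) :=
    Abelian.monoIsKernelOfCokernel _ (colimit.isColimit (parallelPair i 0))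
  exact ⟨hk.lift (KernelFork.ofι k h), hk.fac (KernelFork.ofι k h) WalkingParallelPair.zero⟩

theorem mono_cokernel_map {A : Type u} [Category.{v} A] [Abelian A] {M : A} (R L : Subobject M)
    (h : R ≤ L) : Mono (cokernel.map (Subobject.ofLE R L h) R.arrow (𝟙 _) L.arrow (by simp)) := by
  have sq : IsPullback (Subobject.ofLE R L h) (𝟙 _) L.arrow R.arrow := by
    refine ⟨⟨by simp⟩, ⟨PullbackCone.IsLimit.mk _ (fun s => s.snd) ?_ ?_ ?_⟩⟩
    · intro s
      rw [← cancel_mono L.arrow, Category.assoc, Subobject.ofLE_arrow]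
      exact s.condition.symm
    · intro s
      exact Category.comp_id _
    · intro s m _ h2
      rwa [Category.comp_id] at h2
  exact Abelian.mono_cokernel_map_of_isPullback sq

namespace TorsionChain

variable {A : Type u} [Category.{v} A] [Abelian A] (η : TorsionChain A)

theorem t_mem (s : unitInterval) (M : A) : η.T s (η.t s M : A) := torsionSubobject_mem _ _

theorem cokernel_t_mem (s : unitInterval) (M : A) : η.F s (cokernel (η.t s M).arrow) :=
  cokernel_torsionSubobject _ _

theorem t_antitone (M : A) : Antitone fun s => η.t s M := by
  intro r s hrs
  exact le_torsionSubobject _ _ (η.anti r s hrs _ (η.t_mem s M))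

theorem t_zero (M : A) : η.t 0 M = ⊤ :=
  top_le_iff.1 (le_torsionSubobject _ _ (η.zero_mem _))

theorem t_one (M : A) : η.t 1 M = ⊥ := by
  have h : IsZero (η.t 1 M : A) := (η.one_iff _).1 (η.t_mem 1 M)
  have h0 : (η.t 1 M).arrow = 0 := h.eq_of_src _ _
  rw [← Subobject.mk_arrow (η.t 1 M)]
  exact Subobject.mk_eq_bot_iff_zero.2 h0

theorem F_mono {r s : unitInterval} (h : r ≤ s) {M : A} (hM : η.F r M) : η.F s M :=
  fun _ f hX => hM f (η.anti r s h _ hX)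

theorem phase_cokernel (x : unitInterval) {M : A} (R L : Subobject M) (h : R ≤ L)
    (hL : ∀ s, s < x → η.T s (L : A)) (hR : ∀ s, x < s → η.F s (cokernel R.arrow)) :
    η.phase x (cokernel (Subobject.ofLE R L h)) := by
  refine ⟨fun s hs => Tors.of_epi (η.mem_tors s) (cokernel.π _) (hL s hs), fun s hs X f hX => ?_⟩
  have := mono_cokernel_map R L h
  exact (Preadditive.mono_iff_cancel_zero _).1 this X f (hR s hs _ hX)

theorem phase_additive (x : unitInterval) : IsAdditiveSubcategory (η.phase x) where
  of_isZero X hX :=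
    ⟨fun s _ => (Tors.additive (η.mem_tors s)).of_isZero X hX, fun _ _ _ _ _ => hX.eq_of_tgt _ _⟩
  of_iso X Y e hX := by
    refine ⟨fun s hs => (Tors.additive (η.mem_tors s)).of_iso X Y e (hX.1 s hs), fun s hs Z f hZ => ?_⟩
    rw [← cancel_mono e.inv, zero_comp]
    exact hX.2 s hs _ hZ
  biprod X Y hX hY := by
    refine ⟨fun s hs => (Tors.additive (η.mem_tors s)).biprod X Y (hX.1 s hs) (hY.1 s hs),
      fun s hs Z f hZ => ?_⟩
    apply biprod.hom_ext
    · rw [zero_comp]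
      exact hX.2 s hs _ hZ
    · rw [zero_comp]
      exact hY.2 s hs _ hZ

theorem phase_hom_eq_zero (r s : unitInterval) (h : s < r) (M N : A) (hM : η.phase r M)
    (hN : η.phase s N) (f : M ⟶ N) : f = 0 := by
  obtain ⟨c, h1, h2⟩ := exists_between h
  exact hN.2 c h1 f (hM.1 c h2)

theorem sub_le_t {M : A} (H : HNFiltration η.phase M) (r : unitInterval)
    (j : Fin (H.length + 1)) : (∀ i : Fin H.length, i.castSucc < j → r < H.phase i) →
      H.sub j ≤ η.t r M := by
  induction j using Fin.induction with
  | zero => intro _; rw [H.sub_zero]; exact bot_le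
  | succ j ih =>
    intro h
    have h1 := ih fun i hi => h i (hi.trans j.castSucc_lt_succ)
    have hle := (H.strictMono_sub j.castSucc_lt_succ).le
    apply le_of_comp_cokernel_eq_zero
    have h2 : Subobject.ofLE _ _ hle ≫ (H.sub j.succ).arrow ≫ cokernel.π (η.t r M).arrow = 0 := by
      rw [← Category.assoc, Subobject.ofLE_arrow, ← Subobject.ofLE_arrow h1, Category.assoc,
        cokernel.condition, comp_zero]
    rw [← cokernel.π_desc _ _ h2]
    have h3 : cokernel.desc _ _ h2 = 0 :=
      η.cokernel_t_mem r M _ ((H.factor_mem j).1 r (h j j.castSucc_lt_succ))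
    rw [h3, comp_zero]

theorem t_le_sub {M : A} (H : HNFiltration η.phase M) (r : unitInterval)
    (j : Fin (H.length + 1)) : (∀ i : Fin H.length, j ≤ i.castSucc → H.phase i < r) →
      η.t r M ≤ H.sub j := by
  induction j using Fin.reverseInduction with
  | last => intro _; rw [H.sub_last]; exact le_top
  | cast j ih =>
    intro h
    have h1 := ih fun i hi => h i (j.castSucc_lt_succ.le.trans hi)
    have hle := (H.strictMono_sub j.castSucc_lt_succ).le
    have h2 : Subobject.ofLE _ _ h1 ≫ cokernel.π (Subobject.ofLE _ _ hle) = 0 :=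
      (H.factor_mem j).2 r (h j le_rfl) _ (η.t_mem r M)
    obtain ⟨l, hl⟩ := exists_lift _ _ h2
    refine Subobject.le_of_comm l ?_
    rw [← Subobject.ofLE_arrow h1, ← hl, Category.assoc, Subobject.ofLE_arrow]

open Topology in
theorem range_phase {M : A} (H : HNFiltration η.phase M) :
    Set.range H.phase = {x | ¬ ∀ᶠ r in 𝓝 x, η.t r M = η.t x M} := by
  ext x
  constructor
  · rintro ⟨i, rfl⟩ hev
    set x := H.phase i with hx
    have h1 : H.sub i.succ ≤ η.t x M := by
      rcases eq_or_lt_of_le (unitInterval.nonneg' (t := x)) with h0 | h0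
      · rw [← h0, η.t_zero]
        exact le_top
      · have : (𝓝[<] x).NeBot := nhdsLT_neBot_of_exists_lt ⟨0, h0⟩
        obtain ⟨r, hr1, hr2⟩ :=
          ((hev.filter_mono nhdsWithin_le_nhds).and (self_mem_nhdsWithin (s := Set.Iio x))).exists
        rw [← hr1]
        refine η.sub_le_t H r _ fun j hj => lt_of_lt_of_le hr2 ?_
        exact H.strictAnti_phase.antitone (by rw [Fin.lt_def] at hj; rw [Fin.le_def]; simp at hj; omega)
    have h2 : η.t x M ≤ H.sub i.castSucc := by
      rcases eq_or_lt_of_le (unitInterval.le_one' (t := x)) with h0 | h0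
      · rw [h0, η.t_one]
        exact bot_le
      · have : (𝓝[>] x).NeBot := nhdsGT_neBot_of_exists_gt ⟨1, h0⟩
        obtain ⟨r, hr1, hr2⟩ :=
          ((hev.filter_mono nhdsWithin_le_nhds).and (self_mem_nhdsWithin (s := Set.Ioi x))).exists
        rw [← hr1]
        refine η.t_le_sub H r _ fun j hj => lt_of_le_of_lt ?_ hr2
        exact H.strictAnti_phase.antitone (by rw [Fin.le_def] at hj; rw [Fin.le_def]; simpa using hj)
    exact (H.strictMono_sub i.castSucc_lt_succ).not_ge (h1.trans h2)
  · intro hx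
    by_contra hxr
    apply hx
    -- a position in the filtration that separates the phases above `x` from those below
    obtain ⟨k, hk1, hk2⟩ : ∃ k : Fin (H.length + 1),
        (∀ i : Fin H.length, i.castSucc < k → x < H.phase i) ∧
        (∀ i : Fin H.length, k ≤ i.castSucc → H.phase i < x) := by
      by_cases hex : ∃ i, H.phase i < x
      · have hne : (Finset.univ.filter fun i => H.phase i < x).Nonempty := by
          obtain ⟨i, hi⟩ := hex
          exact ⟨i, by simpa using hi⟩
        set m := (Finset.univ.filter fun i => H.phase i < x).min' hne with hm
        have hm1 : H.phase m < x := by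
          have := Finset.min'_mem _ hne
          rw [← hm] at this
          simpa using this
        refine ⟨m.castSucc, fun i hi => ?_, fun i hi => ?_⟩
        · by_contra hc
          have hlt : H.phase i < x := lt_of_le_of_ne (not_lt.1 hc) fun h => hxr ⟨i, h⟩
          have : m ≤ i := Finset.min'_le _ _ (by simpa using hlt)
          exact absurd hi (not_lt.2 (Fin.castSucc_le_castSucc_iff.2 this))
        · exact (H.strictAnti_phase.antitone (Fin.castSucc_le_castSucc_iff.1 hi)).trans_lt hm1
      · refine ⟨Fin.last _, fun i _ => ?_, fun i hi => ?_⟩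
        · exact lt_of_le_of_ne (not_lt.1 fun h => hex ⟨i, h⟩) fun h => hxr ⟨i, h.symm⟩
        · exact absurd i.castSucc_lt_last (not_lt.2 hi)
    have key : ∀ r, (∀ i : Fin H.length, i.castSucc < k → r < H.phase i) →
        (∀ i : Fin H.length, k ≤ i.castSucc → H.phase i < r) → η.t r M = H.sub k :=
      fun r h1 h2 => le_antisymm (η.t_le_sub H r k h2) (η.sub_le_t H r k h1)
    have ev1 : ∀ᶠ r in 𝓝 x, ∀ i : Fin H.length, i.castSucc < k → r < H.phase i := by
      rw [Filter.eventually_all]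
      intro i
      by_cases hi : i.castSucc < k
      · exact (eventually_lt_nhds (hk1 i hi)).mono fun r hr _ => hr
      · exact Filter.Eventually.of_forall fun r h => absurd h hi
    have ev2 : ∀ᶠ r in 𝓝 x, ∀ i : Fin H.length, k ≤ i.castSucc → H.phase i < r := by
      rw [Filter.eventually_all]
      intro i
      by_cases hi : k ≤ i.castSucc
      · exact (eventually_gt_nhds (hk2 i hi)).mono fun r hr _ => hr
      · exact Filter.Eventually.of_forall fun r h => absurd h hi
    filter_upwards [ev1, ev2] with r hr1 hr2
    rw [key r hr1 hr2, key x hk1 hk2]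

theorem hn_unique (M : A) : Subsingleton (HNFiltration η.phase M) := by
  constructor
  intro H K
  have hrange : Set.range H.phase = Set.range K.phase := by rw [η.range_phase H, η.range_phase K]
  have hlen : H.length = K.length := by
    have h1 := Set.ncard_image_of_injective Set.univ H.strictAnti_phase.injective
    have h2 := Set.ncard_image_of_injective Set.univ K.strictAnti_phase.injective
    rw [Set.image_univ] at h1 h2
    rw [hrange, h2] at h1
    simpa using h1.symm
  have hend : ∀ (H : HNFiltration η.phase M) (i j : Fin H.length), i.succ = j.castSucc →
      ∀ r, H.phase j < r → r < H.phase i → H.sub i.succ = η.t r M := by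
    intro H i j hij r hr1 hr2
    apply le_antisymm
    · refine η.sub_le_t H r _ fun l hl => hr2.trans_le (H.strictAnti_phase.antitone ?_)
      rw [Fin.lt_def] at hl; rw [Fin.le_def]; simp at hl; omega
    · refine η.t_le_sub H r _ fun l hl => (H.strictAnti_phase.antitone ?_).trans_lt hr1
      rw [hij] at hl
      exact Fin.castSucc_le_castSucc_iff.1 hl
  obtain ⟨n, subH, phaseH, zeroH, lastH, monoH, antiH, memH⟩ := H
  obtain ⟨m, subK, phaseK, zeroK, lastK, monoK, antiK, memK⟩ := K
  dsimp only at hrange hlen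
  subst hlen
  have hphase : phaseH = phaseK := (StrictAnti.range_inj antiH antiK).1 hrange
  subst hphase
  have hsub : subH = subK := by
    funext j
    induction j using Fin.cases with
    | zero => rw [zeroH, zeroK]
    | succ i =>
      rcases Fin.eq_castSucc_or_eq_last i.succ with ⟨j, hj⟩ | hl
      · have hlt : phaseH j < phaseH i := antiH (by
          have := congrArg Fin.val hj
          rw [Fin.lt_def]; simp at this; omega)
        obtain ⟨r, hr1, hr2⟩ := exists_between hlt
        exact (hend ⟨_, subH, phaseH, zeroH, lastH, monoH, antiH, memH⟩ i j hj r hr1 hr2).trans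
          (hend ⟨_, subK, phaseH, zeroK, lastK, monoK, antiK, memK⟩ i j hj r hr1 hr2).symm
      · rw [hl, lastH, lastK]
  subst hsub
  rfl

theorem hn_exists (hq : η.QuasiNoetherian) (hw : η.WeaklyArtinian) (M : A) :
    Nonempty (HNFiltration η.phase M) := by
  obtain ⟨n, sub, phase, h0, h1, hs, hp, hspec⟩ := exists_steps (fun s => η.t s M)
    (η.t_antitone M) (η.t_zero M) (η.t_one M) (fun a b hab => hq a b hab M)
    (fun a b hab => hw a b hab M)
  refine ⟨⟨n, sub, phase, h0, h1, hs, hp, fun i => ?_⟩⟩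
  apply η.phase_cokernel
  · intro s hs
    obtain ⟨s', h1, -, h3⟩ := (hspec i).1 s hs
    rw [← h3]
    exact η.anti s s' h1 _ (η.t_mem s' M)
  · intro s hs
    obtain ⟨s', -, h2, h3⟩ := (hspec i).2 s hs
    rw [← h3]
    exact η.F_mono h2 (η.cokernel_t_mem s' M)

end TorsionChain

/-- The slicing of a quasi-Noetherian and weakly-Artinian chain of torsion classes, consisting of
its categories of quasisemistable objects. -/
def ChainSpace.slicing {A : Type u} [Category.{v} A] [Abelian A] (η : ChainSpace A) :
    Slicing A where
  P := η.toTorsionChain.phase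
  additive := η.toTorsionChain.phase_additive
  hom_eq_zero := η.toTorsionChain.phase_hom_eq_zero
  exists_hn M _ := η.toTorsionChain.hn_exists η.quasiNoetherian η.weaklyArtinian M
  unique_hn M _ := η.toTorsionChain.hn_unique M

/-- The quotient topology on the space of slicings along `η ↦ η.slicing`, where the space of
chains carries the topology of Bridgeland's pseudometric. -/
instance {A : Type u} [Category.{v} A] [Abelian A] : TopologicalSpace (Slicing A) :=
  TopologicalSpace.coinduced ChainSpace.slicing inferInstance

end

end TorsionSlicing

/-!
Two facts reduce the theorem to the pseudometric space of chains.

* Every slicing comes from a chain (`slicing_surjective`): take for `T s`, `s < 1`, the objects whose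
  Harder-Narasimhan phases are all at least `s`. The torsion subobject of `M` is then a step of its
  filtration, so `M` has only finitely many torsion subobjects, which makes the chain
  quasi-Noetherian and weakly-Artinian.
* Two chains with the same slicing have distance zero (`dist_eq_zero_of_slicing_eq`): for `s < s'`,
  an object of the class at `s'` of one chain has all its phases above `s`, so it lies in the class
  at `s` of the other, and chains interleaved up to a shift by `ε` have distance at most `ε`
  (`dist_le_of_interleaved`).

Hence open sets of chains are saturated, and the space of slicings is compact if and only if the
space of chains is (`compactSpace_slicing_iff`).

If there are finitely many torsion classes, an ultrafilter on the space of chains has a limit at each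
parameter `s` separately. These limits form a chain, and the ultrafilter converges to it, because
chains that agree on a grid of mesh less than `ε` are interleaved up to `ε`
(`compactSpace_chainSpace_of_finite`).

Conversely, each torsion class `X` gives the chain that is constant with value `X` on `(0,1)`. For
distinct torsion classes, some nonzero object is torsion for one and torsionfree for the other, so
these chains have pairwise distance at least `1`, and a compact space contains only finitely many of
them (`finite_tors_of_compactSpace`).
-/

namespace TorsionSlicing

open Filter Topology

variable {A : Type u} [Category.{v} A] [Abelian A]

/-! ### Orthogonal subcategories and torsion classes -/

theorem isAdditiveSubcategory_leftOrthogonal (Q : ObjectProperty A) :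
    IsAdditiveSubcategory Q.leftOrthogonal where
  of_isZero _ hX _ _ _ := hX.eq_of_src _ _
  of_iso X Y e hX Z f hZ := by
    rw [← cancel_epi e.hom, comp_zero]
    exact hX _ hZ
  biprod X Y hX hY Z f hZ := by
    apply biprod.hom_ext'
    · rw [comp_zero]
      exact hX _ hZ
    · rw [comp_zero]
      exact hY _ hZ

theorem isAdditiveSubcategory_rightOrthogonal (Q : ObjectProperty A) :
    IsAdditiveSubcategory Q.rightOrthogonal where
  of_isZero _ hX _ _ _ := hX.eq_of_tgt _ _
  of_iso X Y e hX Z f hZ := by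
    rw [← cancel_mono e.inv, zero_comp]
    exact hX _ hZ
  biprod X Y hX hY Z f hZ := by
    apply biprod.hom_ext
    · rw [zero_comp]
      exact hX _ hZ
    · rw [zero_comp]
      exact hY _ hZ

theorem mem_tors_of_exists_subobject {T : ObjectProperty A} (hT : IsAdditiveSubcategory T)
    (h : ∀ X : A, ∃ S : Subobject X, T (S : A) ∧ T.rightOrthogonal (cokernel S.arrow)) :
    T ∈ Tors A := by
  refine ⟨T.rightOrthogonal, hT, isAdditiveSubcategory_rightOrthogonal T,
    fun X Y hX hY f => hY f hX, fun X => ?_⟩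
  obtain ⟨S, hS, hS'⟩ := h X
  exact ⟨_, _, S.arrow, cokernel.π S.arrow, cokernel.condition _,
    { exact := ShortComplex.exact_cokernel S.arrow }, hS, hS'⟩

theorem eq_torsionSubobject {T : ObjectProperty A} (hT : T ∈ Tors A) {X : A} (S : Subobject X)
    (h : T (S : A)) (h' : T.rightOrthogonal (cokernel S.arrow)) :
    torsionSubobject hT X = S :=
  le_antisymm (le_of_comp_cokernel_eq_zero _ _ (h' _ (torsionSubobject_mem hT X)))
    (le_torsionSubobject hT S h)

theorem isZero_bot (X : A) : IsZero ((⊥ : Subobject X) : A) :=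
  (isZero_zero A).of_iso (Subobject.botCoeIsoZero)

theorem top_mem_tors : (⊤ : ObjectProperty A) ∈ Tors A := by
  refine mem_tors_of_exists_subobject
    ⟨fun _ _ => trivial, fun _ _ _ _ => trivial, fun _ _ _ _ => trivial⟩
    fun X => ⟨⊤, trivial, fun Y f _ => ?_⟩
  exact (isZero_cokernel_of_epi _).eq_of_tgt _ _

theorem isZero_mem_tors : (fun X : A => IsZero X) ∈ Tors A := by
  refine mem_tors_of_exists_subobject
    ⟨fun _ h => h, fun _ _ e h => h.of_iso e.symm, fun X Y hX hY => ?_⟩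
    fun X => ⟨⊥, isZero_bot X, fun Y f hY => hY.eq_of_src _ _⟩
  rw [IsZero.iff_id_eq_zero]
  apply biprod.hom_ext'
  · exact hX.eq_of_src _ _
  · exact hY.eq_of_src _ _

/-- Two torsion classes `S ⊈ T` are separated by a nonzero object of `S` that is torsionfree with
respect to `T`, namely `X / tX` for any `X` in `S` but not in `T`. -/
theorem exists_mem_rightOrthogonal {S T : ObjectProperty A} (hS : S ∈ Tors A) (hT : T ∈ Tors A)
    {X : A} (hX : S X) (hX' : ¬ T X) :
    ∃ N : A, ¬ IsZero N ∧ S N ∧ T.rightOrthogonal N := by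
  refine ⟨cokernel (torsionSubobject hT X).arrow, fun h => hX' ?_,
    Tors.of_epi hS (cokernel.π _) hX, cokernel_torsionSubobject hT X⟩
  have : Epi (torsionSubobject hT X).arrow :=
    Preadditive.epi_of_cokernel_zero (h.eq_of_tgt _ _)
  have : IsIso (torsionSubobject hT X).arrow := isIso_of_mono_of_epi _
  exact (Tors.additive hT).of_iso _ _ (asIso (torsionSubobject hT X).arrow)
    (torsionSubobject_mem hT X)

/-! ### Chains with finitely many torsion subobjects -/

theorem _root_.Antitone.exists_forall_le_of_finite_range {ι α : Type*} [LinearOrder ι]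
    [PartialOrder α] {t : ι → α} (ht : Antitone t) (hfin : (Set.range t).Finite) {J : Set ι}
    (hJ : J.Nonempty) : ∃ s ∈ J, ∀ r ∈ J, t r ≤ t s := by
  have hfin' : (t '' J).Finite := hfin.subset (Set.image_subset_range t J)
  obtain ⟨_, ⟨s, hs, rfl⟩, hmax⟩ := hfin'.exists_maximal (hJ.image t)
  refine ⟨s, hs, fun r hr => ?_⟩
  rcases le_total r s with h | h
  · exact hmax ⟨r, hr, rfl⟩ (ht h)
  · exact ht h

theorem _root_.Antitone.exists_forall_ge_of_finite_range {ι α : Type*} [LinearOrder ι]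
    [PartialOrder α] {t : ι → α} (ht : Antitone t) (hfin : (Set.range t).Finite) {J : Set ι}
    (hJ : J.Nonempty) : ∃ s ∈ J, ∀ r ∈ J, t s ≤ t r := by
  have hfin' : (t '' J).Finite := hfin.subset (Set.image_subset_range t J)
  obtain ⟨_, ⟨s, hs, rfl⟩, hmin⟩ := hfin'.exists_minimal (hJ.image t)
  refine ⟨s, hs, fun r hr => ?_⟩
  rcases le_total r s with h | h
  · exact ht h
  · exact hmin ⟨r, hr, rfl⟩ (ht h)

/-- A chain of torsion classes for which every object has only finitely many torsion subobjects
is quasi-Noetherian and weakly-Artinian. -/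
def TorsionChain.toChainSpace (η : TorsionChain A)
    (h : ∀ M : A, (Set.range fun s => η.t s M).Finite) : ChainSpace A where
  toTorsionChain := η
  quasiNoetherian _ _ hab M :=
    (η.t_antitone M).exists_forall_le_of_finite_range (h M) (Set.nonempty_Ioo.2 hab)
  weaklyArtinian _ _ hab M :=
    (η.t_antitone M).exists_forall_ge_of_finite_range (h M) (Set.nonempty_Ioo.2 hab)

theorem TorsionChain.finite_range_t (η : TorsionChain A) (h : (Set.range η.T).Finite) (M : A) :
    (Set.range fun s => η.t s M).Finite := by
  have : Finite (Set.range η.T) := h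
  have hmem : ∀ T : Set.range η.T, T.1 ∈ Tors A := by
    rintro ⟨_, s, rfl⟩
    exact η.mem_tors s
  refine (Set.finite_range fun T : Set.range η.T => torsionSubobject (hmem T) M).subset ?_
  rintro _ ⟨s, rfl⟩
  exact ⟨⟨η.T s, s, rfl⟩, rfl⟩

/-! ### Estimates for Bridgeland's pseudometric -/

namespace TorsionChain

theorem le_mho (η : TorsionChain A) {M : A} {i : unitInterval} (h : η.T i M) :
    (i : ℝ) ≤ η.mho M :=
  le_csSup ⟨1, by rintro x ⟨j, rfl, -⟩; exact j.2.2⟩ ⟨i, rfl, h⟩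

theorem omega_le (η : TorsionChain A) {M : A} {i : unitInterval} (h : η.F i M) :
    η.omega M ≤ i :=
  csInf_le ⟨0, by rintro x ⟨j, rfl, -⟩; exact j.2.1⟩ ⟨i, rfl, h⟩

theorem mho_le_add (η₁ η₂ : TorsionChain A) {ε : ℝ} (hε : 0 ≤ ε)
    (h : ∀ s s' : unitInterval, (s : ℝ) + ε < s' → ∀ M : A, η₁.T s' M → η₂.T s M) (M : A) :
    η₁.mho M ≤ η₂.mho M + ε := by
  have h0 := (mho_mem η₂ M).1
  refine Real.sSup_le ?_ (by linarith)
  rintro x ⟨i, rfl, hi⟩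
  by_contra! hc
  obtain ⟨s, hs1, hs2⟩ := exists_between (lt_sub_iff_add_lt.2 hc)
  have hi1 := i.2.2
  exact hs1.not_ge (η₂.le_mho (i := ⟨s, by linarith, by linarith⟩)
    (h ⟨s, by linarith, by linarith⟩ i (by dsimp only; linarith) M hi))

theorem omega_le_add (η₁ η₂ : TorsionChain A) {ε : ℝ} (hε : 0 ≤ ε)
    (h : ∀ s s' : unitInterval, (s : ℝ) + ε < s' → ∀ M : A, η₂.T s' M → η₁.T s M) (M : A) :
    η₂.omega M ≤ η₁.omega M + ε := by
  have h1 := (omega_mem η₂ M).2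
  rw [← sub_le_iff_le_add]
  refine le_csInf ⟨1, 1, rfl, fun X f hX => ((η₁.one_iff X).1 hX).eq_of_src _ _⟩ ?_
  rintro x ⟨i, rfl, hi⟩
  by_contra! hc
  obtain ⟨s, hs1, hs2⟩ := exists_between (lt_sub_iff_add_lt.1 hc)
  have hi0 := i.2.1
  exact hs2.not_ge (η₂.omega_le (i := ⟨s, by linarith, by linarith⟩)
    fun X f hX => hi f (h i ⟨s, by linarith, by linarith⟩ hs1 X hX))

end TorsionChain

/-- Chains that are interleaved up to a shift of the parameter by `ε` have distance at most `ε`. -/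
theorem dist_le_of_interleaved (η₁ η₂ : ChainSpace A) {ε : ℝ} (hε : 0 ≤ ε)
    (h₁ : ∀ s s' : unitInterval, (s : ℝ) + ε < s' → ∀ M : A, η₁.T s' M → η₂.T s M)
    (h₂ : ∀ s s' : unitInterval, (s : ℝ) + ε < s' → ∀ M : A, η₂.T s' M → η₁.T s M) :
    dist η₁ η₂ ≤ ε := by
  refine Real.sSup_le ?_ hε
  rintro x ⟨M, -, rfl | rfl⟩
  · rw [abs_sub_le_iff]
    have := TorsionChain.mho_le_add _ _ hε h₁ M
    have := TorsionChain.mho_le_add _ _ hε h₂ M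
    constructor <;> linarith
  · rw [abs_sub_le_iff]
    have := TorsionChain.omega_le_add _ _ hε h₁ M
    have := TorsionChain.omega_le_add _ _ hε h₂ M
    constructor <;> linarith

/-! ### Slicings determine chains up to distance zero -/

theorem TorsionChain.T_of_phase_eq (η₁ η₂ : TorsionChain A) (h : η₁.phase = η₂.phase)
    {s s' : unitInterval} (hs : s < s') {M : A} (hM : η₁.T s' M) (H : HNFiltration η₁.phase M) :
    η₂.T s M := by
  have hphase : ∀ i : Fin H.length, s < H.phase i := by
    intro i
    refine hs.trans_le (le_of_not_gt fun hlt => ?_)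
    -- otherwise the last phase is less than `s'`, and the torsion subobject of `M` for `s'`, which
    -- is `M` itself, lies in the last proper step of the filtration
    have hpos : 0 < H.length := i.pos
    have hle : η₁.t s' M ≤ H.sub (Fin.castSucc ⟨H.length - 1, by omega⟩) := by
      refine η₁.t_le_sub H s' _ fun j hj => lt_of_le_of_lt (H.strictAnti_phase.antitone ?_) hlt
      rw [Fin.le_def] at hj ⊢
      have := i.2
      simp at hj
      omega
    have htop : η₁.t s' M = ⊤ :=
      top_le_iff.1 (le_torsionSubobject (η₁.mem_tors s') ⊤
        ((Tors.additive (η₁.mem_tors s')).of_iso _ _ (asIso (⊤ : Subobject M).arrow).symm hM))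
    rw [htop, top_le_iff] at hle
    exact (H.strictMono_sub (Fin.castSucc_lt_succ (i := ⟨H.length - 1, by omega⟩))).not_ge
      (hle ▸ le_top)
  have htop : η₂.t s M = ⊤ := by
    rw [← top_le_iff, ← H.sub_last]
    revert H
    rw [h]
    intro H hphase
    exact η₂.sub_le_t H s _ fun i _ => hphase i
  have := η₂.t_mem s M
  rw [htop] at this
  exact (Tors.additive (η₂.mem_tors s)).of_iso _ _ (asIso (⊤ : Subobject M).arrow) this

theorem dist_eq_zero_of_slicing_eq (η₁ η₂ : ChainSpace A) (h : η₁.slicing = η₂.slicing) :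
    dist η₁ η₂ = 0 := by
  have h' : η₁.phase = η₂.phase := congrArg Slicing.P h
  refine le_antisymm (dist_le_of_interleaved η₁ η₂ le_rfl ?_ ?_) dist_nonneg
  · intro s s' hs M hM
    obtain ⟨H⟩ := η₁.hn_exists η₁.quasiNoetherian η₁.weaklyArtinian M
    exact η₁.T_of_phase_eq _ h' (by simpa using hs) hM H
  · intro s s' hs M hM
    obtain ⟨H⟩ := η₂.hn_exists η₂.quasiNoetherian η₂.weaklyArtinian M
    exact η₂.T_of_phase_eq _ h'.symm (by simpa using hs) hM H

/-- Every open set of chains is a union of fibres of `η ↦ η.slicing`, so that the quotient topology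
on slicings has the same open sets as the pseudometric topology. -/
theorem isInducing_slicing : IsInducing (ChainSpace.slicing (A := A)) := by
  refine ⟨le_antisymm continuous_coinduced_rng.le_induced fun U hU => ?_⟩
  have hsat : ChainSpace.slicing ⁻¹' (ChainSpace.slicing '' U) = U := by
    refine (Set.subset_preimage_image _ _).antisymm' ?_
    rintro η ⟨η', hη', h⟩
    exact ((Metric.inseparable_iff.2 (dist_eq_zero_of_slicing_eq _ _ h)).mem_open_iff hU).1 hη'
  refine ⟨ChainSpace.slicing '' U, ?_, hsat⟩
  rw [isOpen_coinduced, hsat]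
  exact hU

/-! ### Every slicing comes from a chain -/

theorem exists_lift_cokernel {M X : A} (R L : Subobject M) (h : R ≤ L)
    (f : X ⟶ cokernel R.arrow)
    (hf : f ≫ cokernel.desc R.arrow (cokernel.π L.arrow)
      (by rw [← Subobject.ofLE_arrow h, Category.assoc, cokernel.condition, comp_zero]) = 0) :
    ∃ l : X ⟶ cokernel (Subobject.ofLE R L h),
      l ≫ cokernel.map (Subobject.ofLE R L h) R.arrow (𝟙 _) L.arrow (by simp) = f := by
  have := mono_cokernel_map R L h
  apply exists_lift
  -- lift `f` to `M` along an epimorphism `p`; the lift lands in `L`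
  obtain ⟨Y, p, hp, y, hy⟩ := surjective_up_to_refinements_of_epi (cokernel.π R.arrow) f
  have hy0 : y ≫ cokernel.π L.arrow = 0 := by
    have h2 := congrArg (p ≫ ·) hf
    rw [← Category.assoc, hy, Category.assoc, cokernel.π_desc, comp_zero] at h2
    exact h2
  obtain ⟨l, rfl⟩ := exists_lift L.arrow y hy0
  have h3 : L.arrow ≫ cokernel.π R.arrow = cokernel.π (Subobject.ofLE R L h) ≫
      cokernel.map (Subobject.ofLE R L h) R.arrow (𝟙 _) L.arrow (by simp) := by simp
  rw [← cancel_epi p, comp_zero, ← Category.assoc, hy, Category.assoc, Category.assoc,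
    reassoc_of% h3, cokernel.condition, comp_zero, comp_zero]

namespace Slicing

variable (P : Slicing A)

/-- The objects all of whose Harder-Narasimhan phases with respect to `P` are at least `s`,
described as those without nonzero morphisms to objects of `P r`, `r < s`. -/
def torsionClass (s : unitInterval) : ObjectProperty A :=
  ObjectProperty.leftOrthogonal fun N => ∃ r, r < s ∧ P.P r N

theorem torsionClass_of_mem {r s : unitInterval} (h : s ≤ r) {M : A} (hM : P.P r M) :
    P.torsionClass s M := by
  rintro N f ⟨q, hq, hN⟩
  exact P.hom_eq_zero r q (hq.trans_le h) M N hM hN f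

theorem torsionClass_sub {M : A} (H : HNFiltration P.P M) (s : unitInterval)
    (j : Fin (H.length + 1)) : (∀ i : Fin H.length, i.castSucc < j → s ≤ H.phase i) →
      P.torsionClass s (H.sub j : A) := by
  induction j using Fin.induction with
  | zero =>
    intro _
    rw [H.sub_zero]
    exact (isAdditiveSubcategory_leftOrthogonal _).of_isZero _ (isZero_bot M)
  | succ j ih =>
    intro h N f hN
    have hle := (H.strictMono_sub j.castSucc_lt_succ).le
    have h1 : Subobject.ofLE _ _ hle ≫ f = 0 :=
      ih (fun i hi => h i (hi.trans j.castSucc_lt_succ)) _ hN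
    rw [← cokernel.π_desc _ _ h1]
    have h2 : cokernel.desc _ _ h1 = 0 :=
      P.torsionClass_of_mem (h j j.castSucc_lt_succ) (H.factor_mem j) _ hN
    rw [h2, comp_zero]

theorem rightOrthogonal_cokernel_sub {M : A} (H : HNFiltration P.P M) (s : unitInterval)
    (j : Fin (H.length + 1)) : (∀ i : Fin H.length, j ≤ i.castSucc → H.phase i < s) →
      (P.torsionClass s).rightOrthogonal (cokernel (H.sub j).arrow) := by
  induction j using Fin.reverseInduction with
  | last =>
    intro _
    rw [H.sub_last]
    exact (isAdditiveSubcategory_rightOrthogonal _).of_isZero _ (isZero_cokernel_of_epi _)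
  | cast j ih =>
    intro h X f hX
    have hle := (H.strictMono_sub j.castSucc_lt_succ).le
    obtain ⟨l, rfl⟩ := exists_lift_cokernel _ _ hle f
      (ih (fun i hi => h i (j.castSucc_lt_succ.le.trans hi)) _ hX)
    rw [hX l ⟨_, h j le_rfl, H.factor_mem j⟩, zero_comp]

/-- The torsion subobject of `M` is the step of the Harder-Narasimhan filtration that separates the
phases `≥ s` from the phases `< s`. -/
theorem exists_sub {M : A} (H : HNFiltration P.P M) (s : unitInterval) :
    ∃ j, P.torsionClass s (H.sub j : A) ∧
      (P.torsionClass s).rightOrthogonal (cokernel (H.sub j).arrow) := by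
  obtain ⟨k, hk, hmax⟩ := (Set.toFinite {k : Fin (H.length + 1) |
    ∀ i : Fin H.length, i.castSucc < k → s ≤ H.phase i}).exists_maximal
      ⟨0, fun i hi => absurd hi (Fin.not_lt_zero _)⟩
  refine ⟨k, P.torsionClass_sub H s k hk, P.rightOrthogonal_cokernel_sub H s k fun i hi => ?_⟩
  by_contra! hc
  have hmem : ∀ l : Fin H.length, l.castSucc < i.succ → s ≤ H.phase l := fun l hl =>
    hc.trans (H.strictAnti_phase.antitone (Fin.castSucc_lt_succ_iff.1 hl))
  have hki : k < i.succ := hi.trans_lt i.castSucc_lt_succ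
  exact hki.not_ge (hmax hmem hki.le)

theorem torsionClass_mem_tors (s : unitInterval) : P.torsionClass s ∈ Tors A := by
  refine mem_tors_of_exists_subobject (isAdditiveSubcategory_leftOrthogonal _) fun X => ?_
  by_cases hX : IsZero X
  · refine ⟨⊤, (isAdditiveSubcategory_leftOrthogonal _).of_isZero _
      (hX.of_iso (asIso (⊤ : Subobject X).arrow)), ?_⟩
    exact (isAdditiveSubcategory_rightOrthogonal _).of_isZero _ (isZero_cokernel_of_epi _)
  · obtain ⟨H⟩ := P.exists_hn X hX
    obtain ⟨j, hj⟩ := P.exists_sub H s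
    exact ⟨_, hj⟩

open Classical in
/-- The chain of torsion classes of a slicing. At `s = 1` the class of objects of phase `1` is
replaced by the zero objects, as a chain has to end there. -/
def chain : TorsionChain A where
  T s := if s = 1 then fun X => IsZero X else P.torsionClass s
  mem_tors s := by
    split_ifs
    · exact isZero_mem_tors
    · exact P.torsionClass_mem_tors s
  anti r s hrs M hM := by
    by_cases hs : s = 1
    · rw [if_pos hs] at hM
      split_ifs
      · exact hM
      · exact (isAdditiveSubcategory_leftOrthogonal _).of_isZero _ hM
    · have hr : r ≠ 1 := fun h => hs (le_antisymm unitInterval.le_one' (h ▸ hrs))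
      rw [if_neg hs] at hM
      rw [if_neg hr]
      rintro N f ⟨q, hq, hN⟩
      exact hM f ⟨q, hq.trans_le hrs, hN⟩
  zero_mem M := by
    rw [if_neg zero_ne_one]
    rintro N f ⟨q, hq, -⟩
    exact absurd hq (not_lt.2 unitInterval.nonneg')
  one_iff M := by rw [if_pos rfl]

theorem chain_T {s : unitInterval} (hs : s < 1) : P.chain.T s = P.torsionClass s :=
  if_neg hs.ne

theorem finite_range_chain_t (M : A) : (Set.range fun s => P.chain.t s M).Finite := by
  by_cases hM : IsZero M
  · have : Subsingleton (Subobject M) := by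
      have hle (S S' : Subobject M) : S ≤ S' := by
        apply le_of_comp_cokernel_eq_zero
        rw [hM.eq_of_tgt S.arrow 0, zero_comp]
      exact ⟨fun S S' => le_antisymm (hle S S') (hle S' S)⟩
    exact Set.toFinite _
  · obtain ⟨H⟩ := P.exists_hn M hM
    refine ((Set.finite_range H.sub).insert ⊥).subset ?_
    rintro _ ⟨s, rfl⟩
    rcases eq_or_lt_of_le (unitInterval.le_one' (t := s)) with rfl | hs
    · exact Or.inl (P.chain.t_one M)
    · obtain ⟨j, hj, hj'⟩ := P.exists_sub H s
      rw [← P.chain_T hs] at hj hj'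
      exact Or.inr ⟨j, (eq_torsionSubobject _ _ hj hj').symm⟩

/-- The outermost filtration steps `M₁ ⊆ M` and `M → M / Mₙ₋₁` show that a quasisemistable object
of phase `x` has a Harder-Narasimhan filtration with the single phase `x`. -/
theorem chain_phase (x : unitInterval) (M : A) : P.chain.phase x M ↔ P.P x M := by
  constructor
  · rintro ⟨h1, h2⟩
    by_cases hM : IsZero M
    · exact (P.additive x).of_isZero M hM
    obtain ⟨H⟩ := P.exists_hn M hM
    have hbt : (⊥ : Subobject M) ≠ ⊤ := fun h => hM <| by
      have h0 := isZero_bot M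
      rw [h] at h0
      exact h0.of_iso (asIso (⊤ : Subobject M).arrow).symm
    have hlow : ∀ i : Fin H.length, x ≤ H.phase i := by
      intro i
      by_contra! hlt
      obtain ⟨s, hs1, hs2⟩ := exists_between hlt
      have hpos := i.pos
      let k : Fin H.length := ⟨H.length - 1, by omega⟩
      have hk : H.phase k ≤ H.phase i := H.strictAnti_phase.antitone (by
        rw [Fin.le_def]; have := i.2; simp only [k]; omega)
      have hklast : k.succ = Fin.last H.length := by
        ext; simp [k]; omega
      have hT := h1 s hs2
      rw [P.chain_T (hs2.trans_le unitInterval.le_one')] at hT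
      have hF := P.rightOrthogonal_cokernel_sub H s k.castSucc fun j hj =>
        (H.strictAnti_phase.antitone (Fin.castSucc_le_castSucc_iff.1 hj)).trans_lt
          (hk.trans_lt hs1)
      have hle : ⊤ ≤ H.sub k.castSucc := le_of_comp_cokernel_eq_zero _ _ (hF _
        ((isAdditiveSubcategory_leftOrthogonal _).of_iso _ _
          (asIso (⊤ : Subobject M).arrow).symm hT))
      rw [← H.sub_last, ← hklast] at hle
      exact (H.strictMono_sub k.castSucc_lt_succ).not_ge hle
    have hupp : ∀ i : Fin H.length, H.phase i ≤ x := by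
      intro i
      by_contra! hlt
      obtain ⟨s, hs1, hs2⟩ := exists_between hlt
      let k : Fin H.length := ⟨0, i.pos⟩
      have hk : H.phase i ≤ H.phase k := H.strictAnti_phase.antitone (Nat.zero_le _)
      have hT := P.torsionClass_sub H s k.succ fun j hj =>
        (hs2.le.trans hk).trans (H.strictAnti_phase.antitone (Fin.castSucc_lt_succ_iff.1 hj))
      rw [← P.chain_T (hs2.trans_le unitInterval.le_one')] at hT
      have hle : H.sub k.succ ≤ H.sub k.castSucc := by
        apply le_of_comp_cokernel_eq_zero
        rw [h2 s hs1 (H.sub k.succ).arrow hT, zero_comp]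
      exact (H.strictMono_sub k.castSucc_lt_succ).not_ge hle
    have heq : ∀ i, H.phase i = x := fun i => le_antisymm (hupp i) (hlow i)
    obtain ⟨n, sub, phase, sub_zero, sub_last, mono, anti, mem⟩ := H
    dsimp only at heq
    match n, sub, phase, sub_zero, sub_last, mono, anti, mem, heq with
    | 0, sub, phase, sub_zero, sub_last, mono, anti, mem, heq =>
      exact absurd (sub_zero.symm.trans sub_last) hbt
    | 1, sub, phase, sub_zero, sub_last, mono, anti, mem, heq =>
      have h0 := mem 0
      rw [heq] at h0
      have hz : Subobject.ofLE _ _ (mono (Fin.castSucc_lt_succ (i := (0 : Fin 1)))).le = 0 := by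
        apply IsZero.eq_of_src
        exact sub_zero ▸ isZero_bot M
      have e1 : cokernel (Subobject.ofLE _ _
          (mono (Fin.castSucc_lt_succ (i := (0 : Fin 1)))).le) ≅ (sub 1 : A) :=
        cokernelIsoOfEq hz ≪≫ cokernelZeroIsoTarget
      have e2 : (sub 1 : A) ≅ M :=
        eqToIso (by rw [show sub 1 = ⊤ from sub_last]) ≪≫ asIso (⊤ : Subobject M).arrow
      exact (P.additive x).of_iso _ _ (e1 ≪≫ e2) h0
    | n + 2, sub, phase, sub_zero, sub_last, mono, anti, mem, heq =>
      have h01 : (0 : Fin (n + 2)) < 1 := by simp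
      exact absurd (anti h01) (by rw [heq, heq]; exact lt_irrefl _)
  · intro hM
    refine ⟨fun s hs => ?_, fun s hs X f hX => ?_⟩
    · rw [P.chain_T (hs.trans_le unitInterval.le_one')]
      exact P.torsionClass_of_mem hs.le hM
    · rcases eq_or_lt_of_le (unitInterval.le_one' (t := s)) with rfl | hs'
      · exact ((P.chain.one_iff X).1 hX).eq_of_src _ _
      · rw [P.chain_T hs'] at hX
        exact hX f ⟨x, hs, hM⟩

end Slicing

theorem slicing_surjective : Function.Surjective (ChainSpace.slicing (A := A)) := by
  intro P
  refine ⟨P.chain.toChainSpace P.finite_range_chain_t, ?_⟩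
  have h : P.chain.phase = P.P := by
    funext x M
    exact propext (P.chain_phase x M)
  cases P
  simp only [ChainSpace.slicing, TorsionChain.toChainSpace, Slicing.mk.injEq]
  exact h

theorem compactSpace_slicing_iff : CompactSpace (Slicing A) ↔ CompactSpace (ChainSpace A) := by
  rw [← isCompact_univ_iff, ← isCompact_univ_iff, isInducing_slicing.isCompact_iff,
    Set.image_univ, slicing_surjective.range_eq]

/-! ### Finitely many torsion classes -/

/-- A limit of chains along an ultrafilter can be formed at each parameter separately, since the
torsion classes take only finitely many values. -/
theorem exists_ultrafilter_limit (hfin : (Tors A).Finite) (U : Ultrafilter (ChainSpace A)) :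
    ∃ η : ChainSpace A, ∀ s, ∀ᶠ ξ : ChainSpace A in U, ξ.T s = η.T s := by
  have hex : ∀ s, ∃ T ∈ Tors A, ∀ᶠ ξ : ChainSpace A in U, ξ.T s = T := by
    intro s
    have : Finite (Tors A) := hfin
    obtain ⟨T, hT⟩ := Ultrafilter.eventually_exists_iff.1
      (Eventually.of_forall fun ξ : ChainSpace A =>
        (⟨⟨ξ.T s, ξ.mem_tors s⟩, rfl⟩ : ∃ T : Tors A, ξ.T s = T.1) :
          ∀ᶠ ξ : ChainSpace A in U, ∃ T : Tors A, ξ.T s = T.1)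
    exact ⟨T.1, T.2, hT⟩
  choose T hT hU using hex
  let η : TorsionChain A :=
    { T := T
      mem_tors := hT
      anti := fun r s hrs M hM => by
        obtain ⟨ξ, hr, hs⟩ := ((hU r).and (hU s)).exists
        rw [← hs] at hM
        rw [← hr]
        exact ξ.anti r s hrs M hM
      zero_mem := fun M => by
        obtain ⟨ξ, h⟩ := (hU 0).exists
        rw [← h]
        exact ξ.zero_mem M
      one_iff := fun M => by
        obtain ⟨ξ, h⟩ := (hU 1).exists
        rw [← h]
        exact ξ.one_iff M }
  refine ⟨η.toChainSpace (η.finite_range_t (hfin.subset ?_)), hU⟩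
  rintro _ ⟨s, rfl⟩
  exact hT s

theorem compactSpace_chainSpace_of_finite (hfin : (Tors A).Finite) :
    CompactSpace (ChainSpace A) := by
  rw [← isCompact_univ_iff, isCompact_iff_ultrafilter_le_nhds]
  intro U _
  obtain ⟨η, hη⟩ := exists_ultrafilter_limit hfin U
  refine ⟨η, trivial, Metric.nhds_basis_closedBall.ge_iff.2 fun ε hε => ?_⟩
  -- a chain that agrees with the limit on a grid of mesh less than `ε` is `ε`-close to it
  obtain ⟨N, hN⟩ := exists_nat_gt (1 / ε)
  have hN0 : (0 : ℝ) < N := (one_div_pos.2 hε).trans hN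
  have hNε : 1 / (N : ℝ) < ε := by
    rw [div_lt_iff₀ hε] at hN
    rw [div_lt_iff₀ hN0, mul_comm]
    exact hN
  let g : Fin (N + 1) → unitInterval := fun k => ⟨k / N, by positivity, by
    rw [div_le_one hN0]
    exact_mod_cast Nat.lt_succ_iff.1 k.2⟩
  have hgrid : ∀ s s' : unitInterval, (s : ℝ) + ε < s' → ∃ k, s ≤ g k ∧ g k ≤ s' := by
    intro s s' hs
    have hs0 : 0 ≤ (s : ℝ) * N := mul_nonneg s.2.1 hN0.le
    have hc := Nat.le_ceil ((s : ℝ) * N)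
    have hc' := Nat.ceil_lt_add_one hs0
    have hlt : (⌈(s : ℝ) * N⌉₊ : ℝ) / N < s' := by
      rw [div_lt_iff₀ hN0]
      have h1 : 1 < ε * N := by rwa [div_lt_iff₀ hN0] at hNε
      nlinarith
    have hle : ⌈(s : ℝ) * N⌉₊ < N + 1 := by
      have := hlt.trans_le s'.2.2
      rw [div_lt_one hN0] at this
      exact (Nat.cast_lt.1 this).trans (Nat.lt_succ_self N)
    refine ⟨⟨_, hle⟩, Subtype.coe_le_coe.1 ?_, Subtype.coe_le_coe.1 hlt.le⟩
    exact (le_div_iff₀ hN0).2 hc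
  have hev : ∀ᶠ ξ : ChainSpace A in U, ∀ k, ξ.T (g k) = η.T (g k) :=
    eventually_all.2 fun k => hη (g k)
  filter_upwards [hev] with ξ hξ
  refine dist_le_of_interleaved ξ η hε.le ?_ ?_
  · intro s s' hs M hM
    obtain ⟨k, hk, hk'⟩ := hgrid s s' hs
    exact η.anti s _ hk M (hξ k ▸ ξ.anti _ s' hk' M hM)
  · intro s s' hs M hM
    obtain ⟨k, hk, hk'⟩ := hgrid s s' hs
    exact ξ.anti s _ hk M ((hξ k).symm ▸ η.anti _ s' hk' M hM)

/-! ### Infinitely many torsion classes -/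

open Classical in
/-- The chain of a single torsion class `X`: it is all of `A` at `0`, then `X` on the open
interval, then the zero objects at `1`. -/
def twoStepChain (X : Tors A) : TorsionChain A where
  T s := if s = 0 then ⊤ else if s = 1 then fun Y => IsZero Y else X.1
  mem_tors s := by
    split_ifs
    · exact top_mem_tors
    · exact isZero_mem_tors
    · exact X.2
  anti r s hrs M hM := by
    by_cases hr : r = 0
    · rw [if_pos hr]
      trivial
    have hs : s ≠ 0 := fun h => hr (le_antisymm (h ▸ hrs) unitInterval.nonneg')
    rw [if_neg hs] at hM
    rw [if_neg hr]
    by_cases hs1 : s = 1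
    · rw [if_pos hs1] at hM
      split_ifs
      · exact hM
      · exact (Tors.additive X.2).of_isZero M hM
    · have hr1 : r ≠ 1 := fun h => hs1 (le_antisymm unitInterval.le_one' (h ▸ hrs))
      rw [if_neg hs1] at hM
      rwa [if_neg hr1]
  zero_mem M := by
    rw [if_pos rfl]
    trivial
  one_iff M := by rw [if_neg one_ne_zero, if_pos rfl]

theorem twoStepChain_T (X : Tors A) {s : unitInterval} (h0 : 0 < s) (h1 : s < 1) :
    (twoStepChain X).T s = X.1 := by
  simp [twoStepChain, h0.ne', h1.ne]

theorem finite_range_twoStepChain_T (X : Tors A) : (Set.range (twoStepChain X).T).Finite := by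
  refine (Set.toFinite {⊤, fun Y : A => IsZero Y, X.1}).subset ?_
  rintro _ ⟨s, rfl⟩
  dsimp only [twoStepChain]
  split_ifs <;> simp

/-- An object of a torsion class has supremum `1` in its two-step chain, and an object of the
torsionfree class has supremum `0`. -/
theorem one_le_abs_mho_sub {X Y : Tors A} {N : A} (hN : ¬ IsZero N) (hX : X.1 N)
    (hY : Y.1.rightOrthogonal N) :
    1 ≤ |(twoStepChain X).mho N - (twoStepChain Y).mho N| := by
  have h1 : 1 ≤ (twoStepChain X).mho N := by
    refine le_of_forall_lt fun c hc => ?_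
    obtain ⟨s, hs, hs1⟩ := exists_between (max_lt hc zero_lt_one)
    rw [max_lt_iff] at hs
    refine hs.1.trans_le ((twoStepChain X).le_mho (i := ⟨s, hs.2.le, hs1.le⟩) ?_)
    rw [twoStepChain_T X (Subtype.coe_lt_coe.1 hs.2) (Subtype.coe_lt_coe.1 hs1)]
    exact hX
  have h0 : (twoStepChain Y).mho N ≤ 0 := by
    refine Real.sSup_le ?_ le_rfl
    rintro _ ⟨i, rfl, hi⟩
    by_contra! hi0
    rcases eq_or_lt_of_le (unitInterval.le_one' (t := i)) with rfl | hi1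
    · exact hN (((twoStepChain Y).one_iff N).1 hi)
    · rw [twoStepChain_T Y (Subtype.coe_lt_coe.1 hi0) hi1] at hi
      exact hN ((IsZero.iff_id_eq_zero N).2 (hY (𝟙 N) hi))
  exact le_trans (by linarith) (le_abs_self _)

theorem one_le_dist_twoStepChain {X Y : Tors A} (h : ¬ X.1 ≤ Y.1) :
    1 ≤ dist ((twoStepChain X).toChainSpace
        ((twoStepChain X).finite_range_t (finite_range_twoStepChain_T X)))
      ((twoStepChain Y).toChainSpace
        ((twoStepChain Y).finite_range_t (finite_range_twoStepChain_T Y))) := by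
  obtain ⟨M, hM, hM'⟩ : ∃ M, X.1 M ∧ ¬ Y.1 M := by
    by_contra! hc
    exact h hc
  obtain ⟨N, hN, hNX, hNY⟩ := exists_mem_rightOrthogonal X.2 Y.2 hM hM'
  exact (one_le_abs_mho_sub hN hNX hNY).trans
    (le_csSup (distSet_bddAbove _ _) ⟨N, hN, Or.inl rfl⟩)

theorem finite_tors_of_compactSpace [CompactSpace (ChainSpace A)] : (Tors A).Finite := by
  let c : Tors A → ChainSpace A := fun X => (twoStepChain X).toChainSpace
    ((twoStepChain X).finite_range_t (finite_range_twoStepChain_T X))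
  obtain ⟨t, -, ht, hcover⟩ :=
    (isCompact_univ (X := ChainSpace A)).finite_cover_balls (e := 1 / 2) (by norm_num)
  have hball : ∀ X : Tors A, ∃ x : t, dist (c X) x < 1 / 2 := by
    intro X
    obtain ⟨x, hx, hX⟩ := Set.mem_iUnion₂.1 (hcover (Set.mem_univ (c X)))
    exact ⟨⟨x, hx⟩, hX⟩
  choose b hb using hball
  have : Finite t := ht
  have hinj : Function.Injective b := by
    intro X Y hXY
    have hlt : dist (c X) (c Y) < 1 := by
      have h1 := hb X
      have h2 := hb Y
      rw [← hXY] at h2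
      linarith [dist_triangle_right (c X) (c Y) (b X)]
    have hle : X.1 ≤ Y.1 := by
      by_contra h
      exact hlt.not_ge (one_le_dist_twoStepChain h)
    have hge : Y.1 ≤ X.1 := by
      by_contra h
      rw [dist_comm] at hlt
      exact hlt.not_ge (one_le_dist_twoStepChain h)
    exact Subtype.ext (le_antisymm hle hge)
  exact Finite.of_injective b hinj

end TorsionSlicing

theorem mainTheorem5 (A : Type u) [Category.{v} A] [Abelian A] :
    CompactSpace (TorsionSlicing.Slicing A) ↔ (TorsionSlicing.Tors A).Finite := by
  rw [TorsionSlicing.compactSpace_slicing_iff]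
  exact ⟨fun _ => TorsionSlicing.finite_tors_of_compactSpace,
    TorsionSlicing.compactSpace_chainSpace_of_finite⟩
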